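/- **Theorem (Danilov theorem).** Let $M:\mathbb R^2\to\mathbb R^2$, $(q',p')=M(q,p)$, be a $C^1$ symplectic map of the plane (it preserves $dq\wedge dp$), and let $K:\mathbb R^2\to\mathbb R$ be an integral of $M$, i.e. a non-constant continuous function with $K\circ M=K$. Let $C$ be a regular simple closed $C^1$ curve contained in a level set $\{K=k\}$ with $M(C)\subseteq C$ (for instance $C=\{K=k\}$, when the level set is such a curve). Suppose that $K$ is $C^1$ near $C$, that $dK\neq 0$ at every point of $C$, and that $\partial K/\partial p\ne 0$ at almost every point of $C$. Let $c$ be a fixed point of $M$ around which $C$ winds exactly once. For $z\in C$ let $R(z)$ be the angle, counted counterclockwise, by which $z$ is rotated about $c$ when it is moved to $M(z)$; it is determined modulo $2\pi$, and $R:C\to\mathbb R$ is taken to be a continuous determination. Then such a function $R$ exists, and for every such $R$ the Poincaré rotation number $$\nu=\lim_{N\to\infty}\frac1{2\pi N}\sum_{n=0}^{N}R_n ,\qquad R_n=R(M^n z),$$ exists for every $z\in C$ and does not depend on $z$. Let $\oint$ be taken once along $C$, and put $\varepsilon=1$ if this is counterclockwise and $\varepsilon=-1$ if it is clockwise. For every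 point $(q,p)\in C$ with image $(q',p')=M(q,p)$ and every arc from $(q,p)$ to $(q',p')$ along $C$ (run through in either direction, possibly with several turns), both integrals below converge absolutely, the denominator is not zero, and $$\nu=\varepsilon\;\frac{\displaystyle\int_q^{q'}\Big(\frac{\partial K}{\partial p}\Big)^{-1}dq}{\displaystyle\oint\Big(\frac{\partial K}{\partial p}\Big)^{-1}dq}+m ,$$ where both integrals are evaluated along $C$ and $m$ is the integer for which $R(q,p)-2\pi m$ is the angle about $c$ swept along the chosen arc. In particular $\nu$ is $\varepsilon$ times the quotient of the integrals modulo $1$, and it is equal to it when the arc is the one that sweeps the angle $R(q,p)$. -/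

import Mathlib

open Real Set Filter Topology MeasureTheory

/-- A symplectic map of the plane with coordinates `(q, p)`: a `C¹` map whose derivative preserves
the area form `dq ∧ dp`. -/
structure IsSymplecticMap (M : ℝ × ℝ → ℝ × ℝ) : Prop where
  contDiff : ContDiff ℝ 1 M
  preserves : ∀ z u v : ℝ × ℝ,
    (fderiv ℝ M z u).1 * (fderiv ℝ M z v).2 - (fderiv ℝ M z u).2 * (fderiv ℝ M z v).1
      = u.1 * v.2 - u.2 * v.1

/-- `K` is an integral of `M`: a non-constant continuous function invariant under `M`. -/
structure IsIntegralOfMotion (M : ℝ × ℝ → ℝ × ℝ) (K : ℝ × ℝ → ℝ) : Prop where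
  continuous : Continuous K
  nonconstant : ∃ z w : ℝ × ℝ, K z ≠ K w
  invariant : ∀ z : ℝ × ℝ, K (M z) = K z

/-- `γ` is a regular `L`-periodic `C¹` parametrization of a simple closed curve in the plane. -/
structure IsSimpleClosedCurve (γ : ℝ → ℝ × ℝ) (L : ℝ) : Prop where
  pos : 0 < L
  contDiff : ContDiff ℝ 1 γ
  regular : ∀ s, deriv γ s ≠ 0
  periodic : Function.Periodic γ L
  injOn : InjOn γ (Ico 0 L)

/-- `θ` is a polar angle of the point `z ≠ c` about the centre `c` (counterclockwise in the
`(q, p)`-plane, determined modulo `2π`). -/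
def IsPolarAngle (c z : ℝ × ℝ) (θ : ℝ) : Prop :=
  ∃ r : ℝ, 0 < r ∧ z = (c.1 + r * cos θ, c.2 + r * sin θ)

/-- `φ` is a continuous polar angle about `c` along the closed curve `γ` of period `L`, and `γ`
winds around `c` exactly once: counterclockwise if `ε = 1`, clockwise if `ε = -1`. -/
structure WindsOnceAround (c : ℝ × ℝ) (γ : ℝ → ℝ × ℝ) (L : ℝ) (φ : ℝ → ℝ) (ε : ℝ) : Prop where
  continuous : Continuous φ
  isPolarAngle : ∀ s, IsPolarAngle c (γ s) (φ s)
  sign : ε = 1 ∨ ε = -1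
  winding : ∀ s, φ (s + L) = φ s + 2 * π * ε

/-- `R z` is the angle by which `z ∈ C` is rotated about `c` when it is moved to `M z`. As an angle
it is determined modulo `2π`; a determination that is continuous on the curve `C` is taken. -/
structure IsRotationAngle (M : ℝ × ℝ → ℝ × ℝ) (c : ℝ × ℝ) (C : Set (ℝ × ℝ))
    (R : ℝ × ℝ → ℝ) : Prop where
  continuousOn : ContinuousOn R C
  isPolarAngle : ∀ z ∈ C, ∀ θ, IsPolarAngle c z θ → IsPolarAngle c (M z) (θ + R z)

/-- `ν` is the Poincaré rotation number of the orbit of `z`: the limit of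
`(1 / (2πN)) ∑_{n=0}^{N} R_n`, where `R_n = R (Mⁿ z)` is the rotation angle between the `n`-th and
the `(n+1)`-st point of the orbit. -/
def HasRotationNumber (M : ℝ × ℝ → ℝ × ℝ) (R : ℝ × ℝ → ℝ) (z : ℝ × ℝ) (ν : ℝ) : Prop :=
  Tendsto (fun N : ℕ => 1 / (2 * π * (N : ℝ)) * ∑ n ∈ Finset.range (N + 1), R (M^[n] z))
    atTop (𝓝 ν)

/-- The partial derivative `∂K/∂p`. -/
noncomputable def partialP (K : ℝ × ℝ → ℝ) (z : ℝ × ℝ) : ℝ :=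
  fderiv ℝ K z (0, 1)

/-- The differential form `(∂K/∂p)⁻¹ dq` pulled back along the parametrized curve `γ`. -/
noncomputable def danilovIntegrand (K : ℝ × ℝ → ℝ) (γ : ℝ → ℝ × ℝ) (s : ℝ) : ℝ :=
  (partialP K (γ s))⁻¹ * (deriv γ s).1

/-! Along `C` the Hamiltonian field `X = (∂K/∂p, -∂K/∂q)` is tangent and nowhere zero, so time along
`X`, with `dt = dq / (∂K/∂p)`, is a coordinate on `C`. A symplectic map that preserves `K` carries
`X` to itself (`IsSymplecticMap.fderiv_hamiltonianField`), so in this coordinate `M` is a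
translation by a constant `a` (`integral_timeDensity_lift_eq`), while one turn takes time `T ≠ 0`.
The angle about `c` gains `2πε` per turn; it therefore differs from `2πε/T` times the time by a
bounded periodic function, and its mean gain per step is `2πε a/T` (`tendsto_average_displacement`).
No flow is used, as `X` is only continuous: time is the integral of `timeDensity`, a continuous
function that makes sense also where `∂K/∂p = 0` and equals the integrand of the theorem almost
everywhere. -/

theorem IsPolarAngle.exists_sub_eq {c z : ℝ × ℝ} {θ θ' : ℝ} (h : IsPolarAngle c z θ)
    (h' : IsPolarAngle c z θ') : ∃ j : ℤ, θ - θ' = 2 * π * j := by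
  obtain ⟨r, hr, rfl⟩ := h
  obtain ⟨r', hr', h'⟩ := h'
  simp only [Prod.mk.injEq, add_right_inj] at h'
  obtain ⟨h1, h2⟩ := h'
  have hsq : r ^ 2 = r' ^ 2 := by
    linear_combination (r * cos θ + r' * cos θ') * h1 + (r * sin θ + r' * sin θ') * h2
      - r ^ 2 * sin_sq_add_cos_sq θ + r' ^ 2 * sin_sq_add_cos_sq θ'
  have hrr : r = r' := (sq_eq_sq₀ hr.le hr'.le).1 hsq
  subst hrr
  exact Real.Angle.angle_eq_iff_two_pi_dvd_sub.1 (Real.Angle.cos_sin_inj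
    (mul_left_cancel₀ hr.ne' h1) (mul_left_cancel₀ hr.ne' h2))

theorem IsPolarAngle.add_two_pi_mul_int {c z : ℝ × ℝ} {θ : ℝ} (h : IsPolarAngle c z θ) (j : ℤ) :
    IsPolarAngle c z (θ + 2 * π * j) := by
  obtain ⟨r, hr, rfl⟩ := h
  refine ⟨r, hr, ?_⟩
  rw [show θ + 2 * π * j = θ + j * (2 * π) by ring, cos_add_int_mul_two_pi,
    sin_add_int_mul_two_pi]

/-- A continuous real function with values in `2πℤ` is constant. -/
theorem exists_int_forall_eq_of_continuous {f : ℝ → ℝ} (hf : Continuous f)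
    (h : ∀ s, ∃ j : ℤ, f s = 2 * π * j) : ∃ m : ℤ, ∀ s, f s = 2 * π * m := by
  choose j hj using h
  have hemb : IsClosedEmbedding ((↑) : ℤ → ℝ) := Int.isClosedEmbedding_coe_real
  have hjc : Continuous j := by
    rw [hemb.isInducing.continuous_iff]
    have : ((↑) : ℤ → ℝ) ∘ j = fun s => f s / (2 * π) := by
      funext s
      have := hj s
      have := pi_pos
      simp only [Function.comp]
      field_simp
      linarith
    rw [this]
    fun_prop
  refine ⟨j 0, fun s => ?_⟩
  rw [hj s, PreconnectedSpace.constant inferInstance hjc (x := s) (y := 0)]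

/-! ### Lifting from the closed curve to its parameter -/

namespace IsSimpleClosedCurve

variable {γ : ℝ → ℝ × ℝ} {L : ℝ}

theorem exists_sub_eq (hγ : IsSimpleClosedCurve γ L) {s t : ℝ} (h : γ s = γ t) :
    ∃ j : ℤ, s - t = j * L := by
  have key : toIcoMod hγ.pos 0 s = toIcoMod hγ.pos 0 t := by
    apply hγ.injOn
    · simpa using toIcoMod_mem_Ico hγ.pos 0 s
    · simpa using toIcoMod_mem_Ico hγ.pos 0 t
    · simp only [toIcoMod]
      rw [hγ.periodic.sub_zsmul_eq, hγ.periodic.sub_zsmul_eq, h]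
  refine ⟨toIcoDiv hγ.pos 0 s - toIcoDiv hγ.pos 0 t, ?_⟩
  simp only [toIcoMod, zsmul_eq_mul] at key
  push_cast
  linarith

/-- The curve as a closed embedding of the circle. -/
theorem isClosedEmbedding_lift (hγ : IsSimpleClosedCurve γ L) :
    IsClosedEmbedding (hγ.periodic.lift : AddCircle L → ℝ × ℝ) := by
  have : Fact (0 < L) := ⟨hγ.pos⟩
  have hc : Continuous (hγ.periodic.lift : AddCircle L → ℝ × ℝ) :=
    continuous_quot_lift _ hγ.contDiff.continuous
  refine hc.isClosedEmbedding ?_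
  intro x y
  induction x using QuotientAddGroup.induction_on with | H s => ?_
  induction y using QuotientAddGroup.induction_on with | H t => ?_
  intro h
  obtain ⟨j, hj⟩ := hγ.exists_sub_eq (by simpa using h)
  rw [QuotientAddGroup.eq, AddSubgroup.mem_zmultiples_iff]
  exact ⟨-j, by simp only [zsmul_eq_mul]; push_cast; linarith⟩

/-- A continuous function on the line with values in the curve can be lifted to the parameter. -/
theorem exists_continuous_lift (hγ : IsSimpleClosedCurve γ L) {f : ℝ → ℝ × ℝ} (hf : Continuous f)
    (hrange : ∀ s, f s ∈ range γ) {s₀ s₁ : ℝ} (h₀ : γ s₁ = f s₀) :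
    ∃ σ : ℝ → ℝ, Continuous σ ∧ σ s₀ = s₁ ∧ ∀ s, γ (σ s) = f s := by
  choose g hg using hrange
  have hG : Continuous (fun s => (g s : AddCircle L)) := by
    rw [hγ.isClosedEmbedding_lift.isInducing.continuous_iff]
    convert hf using 1
    funext s
    simpa using hg s
  have hinj := hγ.isClosedEmbedding_lift.injective
  -- Read on the circle, `f` is a path, which lifts uniquely through the covering `ℝ → AddCircle L`
  -- once its value at `s₀` is prescribed.
  obtain ⟨F, ⟨hF0, hF⟩, -⟩ := (AddCircle.isCoveringMap_coe L).existsUnique_continuousMap_lifts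
    ⟨_, hG⟩ s₀ s₁ (hinj (by simpa [hg] using h₀))
  refine ⟨F, F.continuous, hF0, fun s => ?_⟩
  have := congrArg hγ.periodic.lift (congrFun hF s)
  simpa [hg] using this

/-- A continuous periodic function of the parameter is a continuous function on the curve. -/
theorem exists_continuousOn_range (hγ : IsSimpleClosedCurve γ L) {g : ℝ → ℝ} (hg : Continuous g)
    (hper : Function.Periodic g L) :
    ∃ R : ℝ × ℝ → ℝ, ContinuousOn R (range γ) ∧ ∀ s, R (γ s) = g s := by
  have hemb := hγ.isClosedEmbedding_lift
  have hR : ∀ x : AddCircle L, Function.extend hγ.periodic.lift hper.lift 0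
      (hγ.periodic.lift x) = hper.lift x := fun x => hemb.injective.extend_apply _ _ x
  refine ⟨Function.extend (hγ.periodic.lift : AddCircle L → ℝ × ℝ) hper.lift 0, ?_, fun s => ?_⟩
  · have hrange : range γ = range (hγ.periodic.lift : AddCircle L → ℝ × ℝ) := by
      refine Subset.antisymm ?_ ?_
      · rintro _ ⟨s, rfl⟩
        exact ⟨(s : AddCircle L), by simp⟩
      · rintro _ ⟨x, rfl⟩
        induction x using QuotientAddGroup.induction_on with | H s => exact ⟨s, by simp⟩
    have hgc : Continuous (hper.lift : AddCircle L → ℝ) := continuous_quot_lift _ hg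
    rw [continuousOn_iff_isClosed]
    refine fun t ht => ⟨_, hemb.isClosedMap _ (ht.preimage hgc), ?_⟩
    rw [hrange]
    ext z
    constructor
    · rintro ⟨hz, x, rfl⟩
      exact ⟨⟨x, by simpa [hR] using hz, rfl⟩, x, rfl⟩
    · rintro ⟨⟨x, hx, rfl⟩, hz⟩
      exact ⟨by simpa [hR] using hx, hz⟩
  · simpa using hR (s : AddCircle L)

theorem hasStrictDerivAt (hγ : IsSimpleClosedCurve γ L) (s : ℝ) :
    HasStrictDerivAt γ (deriv γ s) s :=
  hγ.contDiff.contDiffAt.hasStrictDerivAt one_ne_zero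

theorem continuous_deriv (hγ : IsSimpleClosedCurve γ L) : Continuous (deriv γ) :=
  hγ.contDiff.continuous_deriv le_rfl

end IsSimpleClosedCurve

/-- If `f ∘ σ` is differentiable, `σ` is continuous and `f` is strictly differentiable with nonzero
derivative, then `σ` is differentiable. -/
theorem HasStrictDerivAt.exists_hasDerivAt_of_comp {f : ℝ → ℝ} {σ : ℝ → ℝ} {s f' g' : ℝ}
    (hf : HasStrictDerivAt f f' (σ s)) (hf' : f' ≠ 0) (hσ : ContinuousAt σ s)
    (hg : HasDerivAt (f ∘ σ) g' s) : ∃ σ', HasDerivAt σ σ' s := by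
  refine ⟨f'⁻¹ * g', ?_⟩
  -- Near `s`, `σ` is the local inverse of `f` applied to `f ∘ σ`.
  have h := HasDerivAt.comp s (hf.to_localInverse hf').hasDerivAt hg
  refine h.congr_of_eventuallyEq ?_
  filter_upwards [hσ.eventually (hf.eventually_left_inverse hf')] with t ht
  exact ht.symm

/-- The planar version of `HasStrictDerivAt.exists_hasDerivAt_of_comp`. -/
theorem exists_hasDerivAt_of_comp_prod {γ : ℝ → ℝ × ℝ} {σ : ℝ → ℝ} {s : ℝ} {v w : ℝ × ℝ}
    (hγ : HasStrictDerivAt γ v (σ s)) (hv : v ≠ 0) (hσ : ContinuousAt σ s)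
    (hw : HasDerivAt (γ ∘ σ) w s) : ∃ σ', HasDerivAt σ σ' s ∧ w = σ' • v := by
  have h1 : HasStrictDerivAt (fun t => (γ t).1) v.1 (σ s) :=
    (ContinuousLinearMap.fst ℝ ℝ ℝ).hasStrictFDerivAt.comp_hasStrictDerivAt _ hγ
  have h2 : HasStrictDerivAt (fun t => (γ t).2) v.2 (σ s) :=
    (ContinuousLinearMap.snd ℝ ℝ ℝ).hasStrictFDerivAt.comp_hasStrictDerivAt _ hγ
  have hw1 : HasDerivAt ((fun t => (γ t).1) ∘ σ) w.1 s :=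
    (ContinuousLinearMap.fst ℝ ℝ ℝ).hasFDerivAt.comp_hasDerivAt _ hw
  have hw2 : HasDerivAt ((fun t => (γ t).2) ∘ σ) w.2 s :=
    (ContinuousLinearMap.snd ℝ ℝ ℝ).hasFDerivAt.comp_hasDerivAt _ hw
  have : ∃ σ', HasDerivAt σ σ' s := by
    by_cases hv1 : v.1 = 0
    · have hv2 : v.2 ≠ 0 := fun hv2 => hv (Prod.ext hv1 hv2)
      exact h2.exists_hasDerivAt_of_comp hv2 hσ hw2
    · exact h1.exists_hasDerivAt_of_comp hv1 hσ hw1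
  obtain ⟨σ', h⟩ := this
  exact ⟨σ', h, hw.unique (hγ.hasDerivAt.scomp s h)⟩

/-! ### Hamiltonian field and Hamiltonian time -/

/-- The Hamiltonian vector field of `K`. -/
noncomputable def hamiltonianField (K : ℝ × ℝ → ℝ) (z : ℝ × ℝ) : ℝ × ℝ :=
  (fderiv ℝ K z (0, 1), -fderiv ℝ K z (1, 0))

theorem ContinuousLinearMap.apply_eq_prod_coords {F : Type*} [NormedAddCommGroup F]
    [NormedSpace ℝ F] (A : ℝ × ℝ →L[ℝ] F) (u : ℝ × ℝ) :
    A u = u.1 • A (1, 0) + u.2 • A (0, 1) := by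
  rw [← map_smul, ← map_smul, ← map_add]
  simp

/-- A symplectic map carries the Hamiltonian field of an integral to itself. -/
theorem IsSymplecticMap.fderiv_hamiltonianField {M : ℝ × ℝ → ℝ × ℝ} {K : ℝ × ℝ → ℝ}
    (hM : IsSymplecticMap M) (hK : ∀ z, K (M z) = K z) {z : ℝ × ℝ}
    (hKM : DifferentiableAt ℝ K (M z)) :
    fderiv ℝ M z (hamiltonianField K z) = hamiltonianField K (M z) := by
  have hMz : DifferentiableAt ℝ M z := hM.contDiff.differentiable one_ne_zero z
  have hcomp : fderiv ℝ K z = (fderiv ℝ K (M z)).comp (fderiv ℝ M z) := by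
    rw [← fderiv_comp z hKM hMz]
    congr 1
    funext w
    exact (hK w).symm
  have hdet := hM.preserves z (1, 0) (0, 1)
  have hcoord := (fderiv ℝ K (M z)).apply_eq_prod_coords
  have h10 : fderiv ℝ K z (1, 0) = fderiv ℝ K (M z) (fderiv ℝ M z (1, 0)) := by rw [hcomp]; rfl
  have h01 : fderiv ℝ K z (0, 1) = fderiv ℝ K (M z) (fderiv ℝ M z (0, 1)) := by rw [hcomp]; rfl
  rw [hcoord] at h10 h01
  rw [(fderiv ℝ M z).apply_eq_prod_coords]
  simp only [hamiltonianField, h10, h01]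
  simp only [smul_eq_mul] at *
  ext
  -- By the chain rule, each coordinate of the left side is that of the field at `M z` times the
  -- Jacobian determinant, which is 1.
  · simp only [Prod.fst_add, Prod.smul_fst, smul_eq_mul]
    linear_combination (fderiv ℝ K (M z) (0, 1)) * hdet
  · simp only [Prod.snd_add, Prod.smul_snd, smul_eq_mul]
    linear_combination -(fderiv ℝ K (M z) (1, 0)) * hdet

/-- The derivative of Hamiltonian time with respect to the parameter of a level curve. -/
noncomputable def timeDensity (K : ℝ × ℝ → ℝ) (γ : ℝ → ℝ × ℝ) (s : ℝ) : ℝ :=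
  ((hamiltonianField K (γ s)).1 * (deriv γ s).1 + (hamiltonianField K (γ s)).2 * (deriv γ s).2) /
    ((hamiltonianField K (γ s)).1 ^ 2 + (hamiltonianField K (γ s)).2 ^ 2)

theorem Prod.sq_add_sq_ne_zero {u : ℝ × ℝ} (hu : u ≠ 0) : u.1 ^ 2 + u.2 ^ 2 ≠ 0 := by
  intro h
  apply hu
  ext
  · exact pow_eq_zero_iff two_ne_zero |>.1 (by nlinarith [sq_nonneg u.1, sq_nonneg u.2])
  · exact pow_eq_zero_iff two_ne_zero |>.1 (by nlinarith [sq_nonneg u.1, sq_nonneg u.2])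

theorem hamiltonianField_ne_zero {K : ℝ × ℝ → ℝ} {z : ℝ × ℝ} (h : fderiv ℝ K z ≠ 0) :
    hamiltonianField K z ≠ 0 := by
  intro h0
  apply h
  ext
  · simpa [hamiltonianField] using congrArg Prod.snd h0
  · simpa [hamiltonianField] using congrArg Prod.fst h0

theorem continuous_hamiltonianField_comp {K : ℝ × ℝ → ℝ} {γ : ℝ → ℝ × ℝ} (hγ : Continuous γ)
    (hK : ∀ s, ContDiffAt ℝ 1 K (γ s)) : Continuous fun s => hamiltonianField K (γ s) := by
  have h : Continuous fun s => fderiv ℝ K (γ s) := by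
    rw [continuous_iff_continuousAt]
    intro s
    exact ((hK s).continuousAt_fderiv one_ne_zero).comp hγ.continuousAt
  unfold hamiltonianField
  fun_prop

section LevelCurve

variable {K : ℝ × ℝ → ℝ} {γ : ℝ → ℝ × ℝ} {L k : ℝ}

theorem continuous_timeDensity (hγ : IsSimpleClosedCurve γ L)
    (hK : ∀ s, ContDiffAt ℝ 1 K (γ s)) (hreg : ∀ s, fderiv ℝ K (γ s) ≠ 0) :
    Continuous (timeDensity K γ) := by
  have h1 := continuous_hamiltonianField_comp hγ.contDiff.continuous hK
  have h2 := hγ.continuous_deriv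
  exact ((h1.fst.mul h2.fst).add (h1.snd.mul h2.snd)).div ((h1.fst.pow 2).add (h1.snd.pow 2))
    fun s => Prod.sq_add_sq_ne_zero (hamiltonianField_ne_zero (hreg s))

theorem timeDensity_periodic (hγ : Function.Periodic γ L) :
    Function.Periodic (timeDensity K γ) L := by
  intro s
  have : deriv γ (s + L) = deriv γ s := by
    rw [← deriv_comp_add_const]
    congr 1
    funext t
    exact hγ t
  simp [timeDensity, hγ s, this]

/-- The velocity of a level curve is a multiple of the Hamiltonian field. -/
theorem deriv_eq_timeDensity_smul (hγ : IsSimpleClosedCurve γ L) (hlevel : ∀ s, K (γ s) = k)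
    (hK : ∀ s, ContDiffAt ℝ 1 K (γ s)) (hreg : ∀ s, fderiv ℝ K (γ s) ≠ 0) (s : ℝ) :
    deriv γ s = timeDensity K γ s • hamiltonianField K (γ s) := by
  have h0 : fderiv ℝ K (γ s) (deriv γ s) = 0 := by
    have h := ((hK s).differentiableAt one_ne_zero).hasFDerivAt.comp_hasDerivAt s
      (hγ.hasStrictDerivAt s).hasDerivAt
    have hconst : K ∘ γ = fun _ => k := funext hlevel
    rw [hconst] at h
    exact h.unique (hasDerivAt_const s k)
  rw [ContinuousLinearMap.apply_eq_prod_coords] at h0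
  have hne := Prod.sq_add_sq_ne_zero (hamiltonianField_ne_zero (hreg s))
  simp only [timeDensity, hamiltonianField, smul_eq_mul] at *
  ext
  · simp only [Prod.smul_fst, smul_eq_mul]
    rw [div_mul_eq_mul_div, eq_div_iff hne]
    linear_combination (fderiv ℝ K (γ s) (1, 0)) * h0
  · simp only [Prod.smul_snd, smul_eq_mul]
    rw [div_mul_eq_mul_div, eq_div_iff hne]
    linear_combination (fderiv ℝ K (γ s) (0, 1)) * h0

theorem timeDensity_ne_zero (hγ : IsSimpleClosedCurve γ L) (hlevel : ∀ s, K (γ s) = k)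
    (hK : ∀ s, ContDiffAt ℝ 1 K (γ s)) (hreg : ∀ s, fderiv ℝ K (γ s) ≠ 0) (s : ℝ) :
    timeDensity K γ s ≠ 0 := by
  intro h
  apply hγ.regular s
  rw [deriv_eq_timeDensity_smul hγ hlevel hK hreg s, h, zero_smul]

/-- The first coordinate of `γ' = timeDensity • X` reads `dq/ds = timeDensity * ∂K/∂p`. -/
theorem danilovIntegrand_eq_timeDensity (hγ : IsSimpleClosedCurve γ L)
    (hlevel : ∀ s, K (γ s) = k) (hK : ∀ s, ContDiffAt ℝ 1 K (γ s))
    (hreg : ∀ s, fderiv ℝ K (γ s) ≠ 0) {s : ℝ} (hs : partialP K (γ s) ≠ 0) :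
    danilovIntegrand K γ s = timeDensity K γ s := by
  rw [danilovIntegrand, deriv_eq_timeDensity_smul hγ hlevel hK hreg s, Prod.smul_fst, smul_eq_mul]
  change (partialP K (γ s))⁻¹ * (timeDensity K γ s * partialP K (γ s)) = _
  field_simp

/-- The time increment of a lift of `M` to the parameter does not depend on the starting point. -/
theorem integral_timeDensity_lift_eq {M : ℝ × ℝ → ℝ × ℝ} (hM : IsSymplecticMap M)
    (hKM : ∀ z, K (M z) = K z) (hγ : IsSimpleClosedCurve γ L) (hlevel : ∀ s, K (γ s) = k)
    (hK : ∀ s, ContDiffAt ℝ 1 K (γ s)) (hreg : ∀ s, fderiv ℝ K (γ s) ≠ 0)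
    {σ : ℝ → ℝ} (hσ : Continuous σ) (hlift : ∀ s, γ (σ s) = M (γ s)) (s t : ℝ) :
    ∫ x in s..σ s, timeDensity K γ x = ∫ x in t..σ t, timeDensity K γ x := by
  have hc := continuous_timeDensity hγ hK hreg
  have hint : ∀ a b, IntervalIntegrable (timeDensity K γ) volume a b :=
    fun a b => hc.intervalIntegrable a b
  set τ : ℝ → ℝ := fun s => ∫ x in (0 : ℝ)..s, timeDensity K γ x with hτ
  have hτd : ∀ s, HasDerivAt τ (timeDensity K γ s) s := fun s =>
    intervalIntegral.integral_hasDerivAt_right (hint 0 s)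
      hc.stronglyMeasurable.stronglyMeasurableAtFilter hc.continuousAt
  have hincr : ∀ s, ∫ x in s..σ s, timeDensity K γ x = τ (σ s) - τ s := fun s =>
    (intervalIntegral.integral_interval_sub_left (hint _ _) (hint _ _)).symm
  have hd : ∀ s, HasDerivAt (fun s => τ (σ s) - τ s) 0 s := by
    intro s
    have hcomp : γ ∘ σ = M ∘ γ := funext hlift
    have hMγ : HasDerivAt (γ ∘ σ) (fderiv ℝ M (γ s) (deriv γ s)) s := by
      rw [hcomp]
      exact (hM.contDiff.differentiable one_ne_zero (γ s)).hasFDerivAt.comp_hasDerivAt s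
        (hγ.hasStrictDerivAt s).hasDerivAt
    obtain ⟨σ', hσ', hw⟩ := exists_hasDerivAt_of_comp_prod (hγ.hasStrictDerivAt (σ s))
      (hγ.regular _) hσ.continuousAt hMγ
    rw [deriv_eq_timeDensity_smul hγ hlevel hK hreg s,
      deriv_eq_timeDensity_smul hγ hlevel hK hreg (σ s), map_smul,
      hM.fderiv_hamiltonianField hKM
        (hlift s ▸ (hK (σ s)).differentiableAt one_ne_zero), ← hlift s, smul_smul] at hw
    -- Both sides of `hw` are multiples of the same nonzero vector `X (γ (σ s))`; equal coefficients
    -- say that `τ ∘ σ` and `τ` have the same derivative.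
    have heq : timeDensity K γ s = σ' * timeDensity K γ (σ s) :=
      smul_left_injective ℝ (hamiltonianField_ne_zero (hreg (σ s))) hw
    have h := (HasDerivAt.comp s (hτd (σ s)) hσ').sub (hτd s)
    rwa [heq, mul_comm, sub_self] at h
  rw [hincr, hincr]
  exact is_const_of_deriv_eq_zero (fun s => (hd s).differentiableAt) (fun s => (hd s).deriv) s t

/-- By Rolle, a zero integral would force the density to vanish somewhere. -/
theorem integral_timeDensity_period_ne_zero (hγ : IsSimpleClosedCurve γ L)
    (hlevel : ∀ s, K (γ s) = k) (hK : ∀ s, ContDiffAt ℝ 1 K (γ s))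
    (hreg : ∀ s, fderiv ℝ K (γ s) ≠ 0) (s : ℝ) :
    ∫ x in s..(s + L), timeDensity K γ x ≠ 0 := by
  have hc := continuous_timeDensity hγ hK hreg
  intro h0
  obtain ⟨x, -, hx⟩ := exists_hasDerivAt_eq_zero
    (f := fun t => ∫ x in s..t, timeDensity K γ x) (f' := timeDensity K γ)
    (lt_add_of_pos_right s hγ.pos)
    (intervalIntegral.differentiable_integral_of_continuous hc).continuous.continuousOn
    (by simp [h0]) (fun t _ => intervalIntegral.integral_hasDerivAt_right
      (hc.intervalIntegrable s t) hc.stronglyMeasurable.stronglyMeasurableAtFilter hc.continuousAt)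
  exact timeDensity_ne_zero hγ hlevel hK hreg x hx

end LevelCurve

/-! ### Rotation angles and their averages -/

/-- The mean displacement of `φ + const` along the orbits of `σ`, when `σ` is conjugated to a
translation by `τ` and `φ` and `τ` grow proportionally. -/
theorem tendsto_average_displacement {φ τ σ : ℝ → ℝ} {L T a ε : ℝ} (m : ℤ) (hL : 0 < L)
    (hT : T ≠ 0) (hφ : Continuous φ) (hφL : ∀ s, φ (s + L) = φ s + 2 * π * ε)
    (hτ : Continuous τ) (hτL : ∀ s, τ (s + L) = τ s + T) (hσ : ∀ s, τ (σ s) = τ s + a) (s : ℝ) :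
    Tendsto (fun N : ℕ => 1 / (2 * π * (N : ℝ)) * ∑ n ∈ Finset.range (N + 1),
      (φ (σ^[n + 1] s) - φ (σ^[n] s) + 2 * π * m)) atTop (𝓝 (ε * (a / T) + m)) := by
  -- The multiple of `τ` is chosen to have the same increment over a period as `φ`, so `b` is
  -- periodic, hence bounded.
  set b : ℝ → ℝ := fun t => φ t - 2 * π * ε / T * τ t with hb
  have hbper : Function.Periodic b L := by
    intro t
    simp only [hb, hφL, hτL]
    field_simp
    ring
  have hbc : Continuous b := by fun_prop
  obtain ⟨B, hB⟩ := isBounded_iff_forall_norm_le.1 (hbper.isBounded_of_continuous hL.ne' hbc)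
  have hiter : ∀ n, τ (σ^[n] s) = τ s + n * a := by
    intro n
    induction n with
    | zero => simp
    | succ n ih =>
      rw [Function.iterate_succ_apply', hσ, ih]
      push_cast
      ring
  have hsum : ∀ N : ℕ, ∑ n ∈ Finset.range (N + 1), (φ (σ^[n + 1] s) - φ (σ^[n] s) + 2 * π * m)
      = (b (σ^[N + 1] s) - b s) + 2 * π * (ε * (a / T) + m) * (N + 1) := by
    intro N
    rw [Finset.sum_add_distrib, Finset.sum_range_sub (fun n => φ (σ^[n] s))]
    simp only [hb, hiter, Finset.sum_const, Finset.card_range, nsmul_eq_mul,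
      Function.iterate_zero_apply]
    push_cast
    field_simp
    ring
  have hinv : Tendsto (fun N : ℕ => ((N : ℝ))⁻¹) atTop (𝓝 0) := tendsto_inv_atTop_nhds_zero_nat
  have h1 : Tendsto (fun N : ℕ => ((N : ℝ))⁻¹ * ((b (σ^[N + 1] s) - b s) / (2 * π)))
      atTop (𝓝 0) := by
    refine hinv.zero_mul_isBoundedUnder_le (isBoundedUnder_of ⟨(B + B) / (2 * π), fun N => ?_⟩)
    simp only [Function.comp, norm_div, norm_mul, Real.norm_ofNat, Real.norm_of_nonneg pi_pos.le]
    gcongr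
    exact (norm_sub_le _ _).trans (add_le_add (hB _ ⟨_, rfl⟩) (hB _ ⟨_, rfl⟩))
  -- There are `N + 1` summands but the divisor is `N`, whence the factor `1 + 1/N`.
  have h2 : Tendsto (fun N : ℕ => ((N : ℝ))⁻¹ * ((b (σ^[N + 1] s) - b s) / (2 * π)) +
      (ε * (a / T) + m) * (1 + ((N : ℝ))⁻¹)) atTop (𝓝 (0 + (ε * (a / T) + m) * (1 + 0))) :=
    h1.add ((hinv.const_add 1).const_mul _)
  rw [zero_add, add_zero, mul_one] at h2
  refine h2.congr' ?_
  filter_upwards [eventually_gt_atTop 0] with N hN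
  have : (N : ℝ) ≠ 0 := by positivity
  have := pi_ne_zero
  rw [hsum]
  generalize ε * (a / T) + m = ν
  field_simp

/-- A lift of `M` to the parameter commutes with the period. -/
theorem lift_add_period {M : ℝ × ℝ → ℝ × ℝ} {γ : ℝ → ℝ × ℝ} {τ σ : ℝ → ℝ} {L T a : ℝ}
    (hγ : IsSimpleClosedCurve γ L) (hT : T ≠ 0) (hτL : ∀ s, τ (s + L) = τ s + T)
    (hσ : ∀ s, τ (σ s) = τ s + a) (hlift : ∀ s, γ (σ s) = M (γ s)) (s : ℝ) :
    σ (s + L) = σ s + L := by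
  -- Periodicity gives `τ (x + j * L) = τ x + j * T` for integers `j`. Since `σ` shifts time by a
  -- constant, the degree `j` of the lift must be 1.
  have hper : Function.Periodic (fun t => τ t - T / L * t) L := by
    intro t
    have := hγ.pos.ne'
    simp only [hτL]
    field_simp
    ring
  obtain ⟨j, hj⟩ := hγ.exists_sub_eq (s := σ (s + L)) (t := σ s)
    (by rw [hlift, hlift, hγ.periodic])
  have h1 : σ (s + L) = σ s + j * L := by linarith
  have h2 := hper.int_mul j (σ s)
  simp only [← h1] at h2
  rw [hσ, hσ, hτL, h1] at h2
  have h3 : T * (1 - j) = 0 := by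
    have := hγ.pos.ne'
    field_simp at h2
    exact mul_right_cancel₀ this (by linear_combination h2)
  have h4 : (j : ℝ) = 1 := by
    have := (mul_eq_zero.1 h3).resolve_left hT
    linarith
  rw [h1, h4, one_mul]

section Rotation

variable {M : ℝ × ℝ → ℝ × ℝ} {c : ℝ × ℝ} {γ : ℝ → ℝ × ℝ} {φ σ : ℝ → ℝ} {L ε : ℝ}

/-- The angular displacement of a periodic lift defines a rotation angle. -/
theorem exists_isRotationAngle (hγ : IsSimpleClosedCurve γ L) (hφ : WindsOnceAround c γ L φ ε)
    (hσ : Continuous σ) (hlift : ∀ s, γ (σ s) = M (γ s)) (hσL : ∀ s, σ (s + L) = σ s + L) :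
    ∃ R : ℝ × ℝ → ℝ, IsRotationAngle M c (range γ) R := by
  have hφc := hφ.continuous
  obtain ⟨R, hRc, hR⟩ := hγ.exists_continuousOn_range (g := fun s => φ (σ s) - φ s)
    (by fun_prop) (fun s => by simp only [hσL, hφ.winding]; ring)
  refine ⟨R, hRc, ?_⟩
  rintro _ ⟨s, rfl⟩ θ hθ
  obtain ⟨j, hj⟩ := hθ.exists_sub_eq (hφ.isPolarAngle s)
  have h := (hφ.isPolarAngle (σ s)).add_two_pi_mul_int j
  rw [hlift] at h
  convert h using 1
  rw [hR]
  linarith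

/-- A rotation angle differs from the angular displacement of a lift by a multiple of `2π`. -/
theorem IsRotationAngle.exists_int_eq {R : ℝ × ℝ → ℝ} (hR : IsRotationAngle M c (range γ) R)
    (hγ : Continuous γ) (hφ : WindsOnceAround c γ L φ ε)
    (hσ : Continuous σ) (hlift : ∀ s, γ (σ s) = M (γ s)) :
    ∃ m : ℤ, ∀ s, R (γ s) = φ (σ s) - φ s + 2 * π * m := by
  have hφc := hφ.continuous
  have hRγ : Continuous fun s => R (γ s) :=
    hR.continuousOn.comp_continuous hγ fun s => ⟨s, rfl⟩
  obtain ⟨m, hm⟩ := exists_int_forall_eq_of_continuous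
    (f := fun s => φ s + R (γ s) - φ (σ s)) ((hφc.add hRγ).sub (hφc.comp hσ)) fun s =>
      (hR.isPolarAngle _ ⟨s, rfl⟩ _ (hφ.isPolarAngle s)).exists_sub_eq
        (hlift s ▸ hφ.isPolarAngle (σ s))
  exact ⟨m, fun s => by linarith [hm s]⟩

end Rotation

theorem mainTheorem1
    (M : ℝ × ℝ → ℝ × ℝ) (K : ℝ × ℝ → ℝ)
    (hM : IsSymplecticMap M) (hK : IsIntegralOfMotion M K)
    -- the invariant closed curve, on a level set of `K`, parametrized by `γ`
    (γ : ℝ → ℝ × ℝ) (L k : ℝ) (hγ : IsSimpleClosedCurve γ L)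
    (hlevel : ∀ s, K (γ s) = k)
    (hinv : MapsTo M (range γ) (range γ))
    -- `K` is `C¹` near the curve and has no critical point on it
    (hKdiff : ∀ s, ContDiffAt ℝ 1 K (γ s))
    (hKreg : ∀ s, fderiv ℝ K (γ s) ≠ 0)
    -- the integrand `(∂K/∂p)⁻¹` is defined almost everywhere along the curve
    (hKp : ∀ᵐ s : ℝ, partialP K (γ s) ≠ 0)
    -- the fixed point encircled by the curve
    (c : ℝ × ℝ) (hc : M c = c)
    (φ : ℝ → ℝ) (ε : ℝ) (hφ : WindsOnceAround c γ L φ ε) :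
    (∃ R : ℝ × ℝ → ℝ, IsRotationAngle M c (range γ) R) ∧
    ∀ s₀ s₁ : ℝ, γ s₁ = M (γ s₀) →
      IntervalIntegrable (danilovIntegrand K γ) volume s₀ s₁ ∧
      IntervalIntegrable (danilovIntegrand K γ) volume s₀ (s₀ + L) ∧
      (∫ s in s₀..(s₀ + L), danilovIntegrand K γ s) ≠ 0 ∧
      ∀ R : ℝ × ℝ → ℝ, IsRotationAngle M c (range γ) R →
        -- `m` compares the branch of `R` with the angle swept along the arc from `s₀` to `s₁`
        ∃ m : ℤ, R (γ s₀) = φ s₁ - φ s₀ + 2 * π * m ∧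
          ∀ z ∈ range γ, HasRotationNumber M R z
            (ε * ((∫ s in s₀..s₁, danilovIntegrand K γ s) /
              ∫ s in s₀..(s₀ + L), danilovIntegrand K γ s) + m) := by
  have hγc := hγ.contDiff.continuous
  have hdc := continuous_timeDensity hγ hKdiff hKreg
  have hint : ∀ a b, IntervalIntegrable (timeDensity K γ) volume a b :=
    fun a b => hdc.intervalIntegrable a b
  -- Only almost everywhere: where `∂K/∂p = 0` the inverse in the integrand is 0 by convention.
  have hae : ∀ᵐ s : ℝ, timeDensity K γ s = danilovIntegrand K γ s := by
    filter_upwards [hKp] with s hs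
    exact (danilovIntegrand_eq_timeDensity hγ hlevel hKdiff hKreg hs).symm
  have hintD : ∀ a b, IntervalIntegrable (danilovIntegrand K γ) volume a b :=
    fun a b => (hint a b).congr_ae (ae_restrict_of_ae hae)
  have hintegral : ∀ a b, ∫ s in a..b, danilovIntegrand K γ s = ∫ s in a..b, timeDensity K γ s :=
    fun a b => (intervalIntegral.integral_congr_ae (hae.mono fun s hs _ => hs)).symm
  have hT := integral_timeDensity_period_ne_zero hγ hlevel hKdiff hKreg
  set τ : ℝ → ℝ := fun s => ∫ x in (0 : ℝ)..s, timeDensity K γ x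
  have hτc : Continuous τ := intervalIntegral.continuous_primitive hint 0
  have hincr : ∀ s t, τ t = τ s + ∫ x in s..t, timeDensity K γ x := fun s t =>
    (intervalIntegral.integral_add_adjacent_intervals (hint _ _) (hint _ _)).symm
  have hτL : ∀ s₀ s, τ (s + L) = τ s + ∫ x in s₀..(s₀ + L), timeDensity K γ x := fun s₀ s => by
    rw [hincr s, (timeDensity_periodic hγ.periodic).intervalIntegral_add_eq s s₀]
  -- The chosen arc selects the lift with `σ s₀ = s₁`; its time is then the translation length at
  -- every starting point.
  have hlift : ∀ s₀ s₁, γ s₁ = M (γ s₀) → ∃ σ : ℝ → ℝ, Continuous σ ∧ σ s₀ = s₁ ∧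
      (∀ s, γ (σ s) = M (γ s)) ∧
      ∀ s, τ (σ s) = τ s + ∫ x in s₀..s₁, timeDensity K γ x := by
    intro s₀ s₁ h
    obtain ⟨σ, hσ, hσ₀, hγσ⟩ := hγ.exists_continuous_lift (hM.contDiff.continuous.comp hγc)
      (fun s => hinv ⟨s, rfl⟩) h
    refine ⟨σ, hσ, hσ₀, hγσ, fun s => ?_⟩
    rw [hincr s, integral_timeDensity_lift_eq hM hK.invariant hγ hlevel hKdiff hKreg hσ hγσ s s₀,
      hσ₀]
  refine ⟨?_, fun s₀ s₁ h => ⟨hintD _ _, hintD _ _, by rw [hintegral]; exact hT s₀, ?_⟩⟩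
  · obtain ⟨s₁, h⟩ := hinv ⟨0, rfl⟩
    obtain ⟨σ, hσ, -, hγσ, hτσ⟩ := hlift 0 s₁ h
    exact exists_isRotationAngle hγ hφ hσ hγσ (lift_add_period hγ (hT 0) (hτL 0) hτσ hγσ)
  · intro R hR
    obtain ⟨σ, hσ, hσ₀, hγσ, hτσ⟩ := hlift s₀ s₁ h
    obtain ⟨m, hm⟩ := hR.exists_int_eq hγc hφ hσ hγσ
    refine ⟨m, by rw [hm, hσ₀], ?_⟩
    rintro _ ⟨s, rfl⟩
    have hsemi : Function.Semiconj γ σ M := hγσ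
    have hRn : ∀ n, R (M^[n] (γ s)) = φ (σ^[n + 1] s) - φ (σ^[n] s) + 2 * π * m := fun n => by
      rw [← (hsemi.iterate_right n).eq, hm, Function.iterate_succ_apply']
    simp only [HasRotationNumber, hRn, hintegral]
    exact tendsto_average_displacement m hγ.pos (hT s₀) hφ.continuous hφ.winding hτc (hτL s₀) hτσ s
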